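/- Let $X$ be a separable infinite-dimensional complex Banach space, let $S$ be a bounded linear operator on $X$, and let $\lambda\in\mathbb C$ with $|\lambda|=1$. A bounded operator $T$ on $X$ is called mixing if for every pair $U,V$ of nonempty open subsets of $X$ there is $N$ such that $T^n(U)\cap V\neq\emptyset$ for all $n>N$. A weighted forward shift on a Schauder basis $(e_n)_{n\ge 0}$ of $X$ is a bounded operator $S$ with $Se_n=w_ne_{n+1}$ for all $n\geq 0$, where $w_n\in\mathbb C$; a weighted bilateral shift on a basis $(e_n)_{n\in\mathbb Z}$ (a two-sided family which, for some enumeration of $\mathbb Z$, is a Schauder basis of $X$) is a bounded operator $S$ with $Se_n=w_ne_{n+1}$ for all $n\in\mathbb Z$, where $w_n\in\mathbb C$. The basis is normalised if $\|e_n\|=1$ for all $n$. (1) If $S$ is a weighted forward shift or a weighted bilateral shift on a normalised basis, with weights $w_n$ for which there is a strictly increasing sequence of indices $(n_j)_{j\ge 1}$ with $|w_{n_j}|\to 0$ as $j\to\infty$, then $\lambda I+S$ lies in the operator-norm closure of the set of mixing operators on $X$. (2) In particular, if $S$ is a weighted forward shift or a weighted bilateral shift on a normalised basis and $S$ is quasinilpotent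 (its spectrum is $\{0\}$), then $\lambda I+S$ lies in the operator-norm closure of the set of mixing operators on $X$. -/

import Mathlib

open Filter Topology

/-- `T` is a mixing operator: for all nonempty open sets `U`, `V` there is `N` such that
`T ^ n (U)` meets `V` for every `n > N`. -/
def IsMixingOperator {X : Type*} [NormedAddCommGroup X] [NormedSpace ℂ X]
    (T : X →L[ℂ] X) : Prop :=
  ∀ U V : Set X, IsOpen U → IsOpen V → U.Nonempty → V.Nonempty →
    ∃ N : ℕ, ∀ n : ℕ, N < n → (((T ^ n : X →L[ℂ] X) '' U) ∩ V).Nonempty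

/-- The set of mixing operators on `X`. Closures of it are taken in the operator norm, which
induces the topology of `X →L[ℂ] X`. -/
def mixingOperators (X : Type*) [NormedAddCommGroup X] [NormedSpace ℂ X] :
    Set (X →L[ℂ] X) :=
  {T | IsMixingOperator T}

/-- The sequence `e 0, e 1, e 2, …` is a Schauder basis of `X`. -/
def IsSchauderBasis {X : Type*} [NormedAddCommGroup X] [NormedSpace ℂ X] (e : ℕ → X) : Prop :=
  ∃ b : SchauderBasis ℂ X, b.basis = e

/-- The two-sided sequence `e` is a Schauder basis of `X` indexed by the integers: for some
enumeration of `ℤ` it is a Schauder basis. This includes the case in which the expansions converge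
as two-sided series, since then `0, 1, -1, 2, -2, …` is such an enumeration. -/
def IsBilateralSchauderBasis {X : Type*} [NormedAddCommGroup X] [NormedSpace ℂ X]
    (e : ℤ → X) : Prop :=
  ∃ σ : ℕ ≃ ℤ, IsSchauderBasis (fun k => e (σ k))

/-- All vectors of the family have norm one. -/
def IsNormalised {X : Type*} [NormedAddCommGroup X] {ι : Type*} (e : ι → X) : Prop :=
  ∀ n, ‖e n‖ = 1

/-- `S` is the forward shift on `e 0, e 1, …` with weights `w`. -/
def IsWeightedForwardShift {X : Type*} [NormedAddCommGroup X] [NormedSpace ℂ X]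
    (S : X →L[ℂ] X) (e : ℕ → X) (w : ℕ → ℂ) : Prop :=
  ∀ n : ℕ, S (e n) = w n • e (n + 1)

/-- `S` is the bilateral shift on `…, e (-1), e 0, e 1, …` with weights `w`. -/
def IsWeightedBilateralShift {X : Type*} [NormedAddCommGroup X] [NormedSpace ℂ X]
    (S : X →L[ℂ] X) (e : ℤ → X) (w : ℤ → ℂ) : Prop :=
  ∀ n : ℤ, S (e n) = w n • e (n + 1)

/-- There is a strictly increasing sequence of indices along which the weights tend to zero.
For `ι = ℤ` such a sequence of indices tends to `+∞`. -/
def HasNullSubsequence {ι : Type*} [Preorder ι] (w : ι → ℂ) : Prop :=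
  ∃ n : ℕ → ι, StrictMono n ∧ Tendsto (fun j => ‖w (n j)‖) atTop (𝓝 0)

/-- `S` is quasinilpotent: its spectrum is `{0}`. -/
def IsQuasinilpotent {X : Type*} [NormedAddCommGroup X] [NormedSpace ℂ X]
    (S : X →L[ℂ] X) : Prop :=
  spectrum ℂ S = {0}

/-! ### Mixing perturbations of the identity, via translation of polynomials. -/

section Mixing

open Polynomial

variable {X : Type*} [NormedAddCommGroup X] [NormedSpace ℂ X]

/-! Small weights can be cut. A small perturbation of `S` replaces the arrow out of each `n j` by
one to the start of the preceding block (by zero for `n 0`) and makes the vanishing weights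
elsewhere nonzero. The new operator `T` is nilpotent at every basis vector, and every basis vector
is, up to a nonzero scalar, the image of another (`isMixingOperator_smul_id_add_of_blocks`).

For such `T` each basis vector lies on a backward orbit ending in zero. On its span `1 + lam⁻¹ • T`
is modelled by p(X) ↦ p(X + 1) on polynomials (`exists_polynomial_model`). Explicit polynomials show
that every vector of the model is both contracting and expanding, and a Kitai-type criterion
(`isMixingOperator_smul_of_dense`) gives mixing.

By Gelfand's formula, quasinilpotency forces a null subsequence of weights. -/

/-- The vectors from which orbits of `A` start that tend to zero, up to arbitrarily small
changes of the starting point. -/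
def contractingVectors (A : X →L[ℂ] X) : Submodule ℂ X where
  carrier := {x | ∃ u : ℕ → X, Tendsto u atTop (𝓝 x) ∧
    Tendsto (fun N => (A ^ N) (u N)) atTop (𝓝 0)}
  zero_mem' := ⟨0, tendsto_const_nhds, by simp⟩
  add_mem' := by
    rintro x y ⟨u, hu, hu'⟩ ⟨v, hv, hv'⟩
    exact ⟨fun N => u N + v N, hu.add hv, by simpa using hu'.add hv'⟩
  smul_mem' := by
    rintro c x ⟨u, hu, hu'⟩
    exact ⟨fun N => c • u N, hu.const_smul c, by simpa using hu'.const_smul c⟩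

/-- The vectors that are limits of `A ^ N (u N)` for a null sequence `u`. -/
def expandingVectors (A : X →L[ℂ] X) : Submodule ℂ X where
  carrier := {x | ∃ u : ℕ → X, Tendsto u atTop (𝓝 0) ∧
    Tendsto (fun N => (A ^ N) (u N)) atTop (𝓝 x)}
  zero_mem' := ⟨0, tendsto_const_nhds, by simp⟩
  add_mem' := by
    rintro x y ⟨u, hu, hu'⟩ ⟨v, hv, hv'⟩
    exact ⟨fun N => u N + v N, by simpa using hu.add hv, by simpa using hu'.add hv'⟩
  smul_mem' := by
    rintro c x ⟨u, hu, hu'⟩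
    exact ⟨fun N => c • u N, by simpa using hu.const_smul c, by simpa using hu'.const_smul c⟩

/-- An operator with densely many contracting and densely many expanding vectors is mixing, also
after multiplication by a unimodular scalar. -/
theorem isMixingOperator_smul_of_dense {A : X →L[ℂ] X} {lam : ℂ} (hlam : ‖lam‖ = 1)
    (hc : Dense (contractingVectors A : Set X)) (he : Dense (expandingVectors A : Set X)) :
    IsMixingOperator (lam • A) := by
  intro U V hU hV hUn hVn
  obtain ⟨x, hxU, u, hu, hu'⟩ := hc.inter_open_nonempty U hU hUn
  obtain ⟨y, hyV, v, hv, hv'⟩ := he.inter_open_nonempty V hV hVn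
  have hlam0 : lam ≠ 0 := by
    rintro rfl
    simp at hlam
  -- The factor `(lam ^ N)⁻¹` cancels the scalar in `(lam • A) ^ N`; being unimodular, it keeps `v`
  -- null.
  have h1 : Tendsto (fun N => u N + (lam ^ N)⁻¹ • v N) atTop (𝓝 x) := by
    have : Tendsto (fun N => (lam ^ N)⁻¹ • v N) atTop (𝓝 0) := by
      rw [tendsto_zero_iff_norm_tendsto_zero] at hv ⊢
      simpa [norm_smul, hlam] using hv
    simpa using hu.add this
  have h2 : Tendsto (fun N => ((lam • A) ^ N) (u N + (lam ^ N)⁻¹ • v N)) atTop (𝓝 y) := by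
    have h3 : Tendsto (fun N => lam ^ N • (A ^ N) (u N)) atTop (𝓝 0) := by
      rw [tendsto_zero_iff_norm_tendsto_zero] at hu' ⊢
      simpa [norm_smul, hlam] using hu'
    have h4 := h3.add hv'
    rw [zero_add] at h4
    refine h4.congr fun N => ?_
    have : lam ^ N ≠ 0 := pow_ne_zero _ hlam0
    rw [_root_.smul_pow, smul_apply, map_add, map_smul, smul_add, smul_smul,
      mul_inv_cancel₀ this, one_smul]
  obtain ⟨N, hN⟩ := eventually_atTop.1
    ((h1.eventually (hU.mem_nhds hxU)).and (h2.eventually (hV.mem_nhds hyV)))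
  exact ⟨N, fun n hn => ⟨_, ⟨_, (hN n hn.le).1, rfl⟩, (hN n hn.le).2⟩⟩

/-- A linear map on polynomials depends continuously on the parameter of a polynomial pencil. -/
theorem continuous_map_mul_pencil_pow (Φ : ℂ[X] →ₗ[ℂ] X) (p q r : ℂ[X]) (m : ℕ) :
    Continuous fun z : ℂ => Φ (p * (q + C z * r) ^ m) := by
  -- `Φ` carries no continuity, but the binomial expansion is a finite sum of powers of z with fixed
  -- coefficients in `X`.
  have : (fun z : ℂ => Φ (p * (q + C z * r) ^ m)) = fun z =>
      ∑ j ∈ Finset.range (m + 1), z ^ (m - j) • Φ (p * q ^ j * r ^ (m - j) * (m.choose j : ℂ[X])) := by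
    ext z
    rw [add_pow, Finset.mul_sum, map_sum]
    refine Finset.sum_congr rfl fun j _ => ?_
    rw [← Φ.map_smul, smul_eq_C_mul, mul_pow, C_pow]
    exact congrArg Φ (by ring)
  rw [this]
  fun_prop

theorem tendsto_map_mul_pencil_pow (Φ : ℂ[X] →ₗ[ℂ] X) (p q r : ℂ[X]) (m : ℕ) :
    Tendsto (fun N : ℕ => Φ (p * (q + C (N : ℂ)⁻¹ * r) ^ m)) atTop (𝓝 (Φ (p * q ^ m))) := by
  have h := (continuous_map_mul_pencil_pow Φ p q r m).tendsto 0
  simp only [map_zero, zero_mul, add_zero] at h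
  exact h.comp (tendsto_inv_atTop_nhds_zero_nat (𝕜 := ℂ))

theorem pow_map_eq_map_comp {A : X →L[ℂ] X} {Φ : ℂ[X] →ₗ[ℂ] X}
    (h : ∀ p, A (Φ p) = Φ (p.comp (Polynomial.X + 1))) (N : ℕ) (p : ℂ[X]) :
    (A ^ N) (Φ p) = Φ (p.comp (Polynomial.X + C (N : ℂ))) := by
  induction N with
  | zero => simp
  | succ N ih =>
    rw [pow_succ', mul_apply_eq_comp, ih, h, comp_assoc]
    congr 2
    simp
    ring

/-- X^n (1 - X/N)^(n+1) tends to X^n, while its translate by N is N⁻¹ (-X)^(n+1) (1 + X/N)^n, which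
tends to 0. -/
theorem map_mem_contractingVectors {A : X →L[ℂ] X} {Φ : ℂ[X] →ₗ[ℂ] X}
    (h : ∀ p, A (Φ p) = Φ (p.comp (Polynomial.X + 1))) (p : ℂ[X]) :
    Φ p ∈ contractingVectors A := by
  induction p using Polynomial.induction_on' with
  | add p q hp hq => rw [map_add]; exact add_mem hp hq
  | monomial n a =>
    rw [← C_mul_X_pow_eq_monomial, ← smul_eq_C_mul, map_smul]
    refine Submodule.smul_mem _ _ ⟨fun N => Φ (Polynomial.X ^ n *
      (1 + C (N : ℂ)⁻¹ * (-Polynomial.X)) ^ (n + 1)), ?_, ?_⟩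
    · simpa using tendsto_map_mul_pencil_pow Φ (Polynomial.X ^ n) 1 (-Polynomial.X) (n + 1)
    · have h1 := (tendsto_inv_atTop_nhds_zero_nat (𝕜 := ℂ)).smul
        (tendsto_map_mul_pencil_pow Φ ((-Polynomial.X) ^ (n + 1)) 1 Polynomial.X n)
      rw [zero_smul] at h1
      refine h1.congr' ?_
      filter_upwards [eventually_gt_atTop 0] with N hN
      have hN' : C (N : ℂ)⁻¹ * C (N : ℂ) = 1 := by
        rw [← C_mul, inv_mul_cancel₀ (Nat.cast_ne_zero.2 hN.ne'), C_1]
      rw [pow_map_eq_map_comp h, ← map_smul, smul_eq_C_mul]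
      congr 1
      simp only [mul_comp, pow_comp, X_comp, add_comp, one_comp, C_comp, neg_comp]
      generalize C (N : ℂ)⁻¹ = a at *
      generalize C (N : ℂ) = b at *
      have e1 : (1 : ℂ[X]) + a * -(Polynomial.X + b) = a * (-Polynomial.X) := by
        linear_combination -hN'
      have e2 : (1 : ℂ[X]) + a * Polynomial.X = a * (Polynomial.X + b) := by
        linear_combination -hN'
      rw [e1, e2]
      simp only [mul_pow]
      ring

/-- N⁻¹ X^(n+1) (-1 + X/N)^n tends to 0, while its translate by N is X^n (1 + X/N)^(n+1), which
tends to X^n. -/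
theorem map_mem_expandingVectors {A : X →L[ℂ] X} {Φ : ℂ[X] →ₗ[ℂ] X}
    (h : ∀ p, A (Φ p) = Φ (p.comp (Polynomial.X + 1))) (p : ℂ[X]) :
    Φ p ∈ expandingVectors A := by
  induction p using Polynomial.induction_on' with
  | add p q hp hq => rw [map_add]; exact add_mem hp hq
  | monomial n a =>
    rw [← C_mul_X_pow_eq_monomial, ← smul_eq_C_mul, map_smul]
    refine Submodule.smul_mem _ _ ⟨fun N => (N : ℂ)⁻¹ • Φ (Polynomial.X ^ (n + 1) *
      (-1 + C (N : ℂ)⁻¹ * Polynomial.X) ^ n), ?_, ?_⟩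
    · simpa using (tendsto_inv_atTop_nhds_zero_nat (𝕜 := ℂ)).smul
        (tendsto_map_mul_pencil_pow Φ (Polynomial.X ^ (n + 1)) (-1) Polynomial.X n)
    · have h1 := tendsto_map_mul_pencil_pow Φ (Polynomial.X ^ n) 1 Polynomial.X (n + 1)
      rw [one_pow, mul_one] at h1
      refine h1.congr' ?_
      filter_upwards [eventually_gt_atTop 0] with N hN
      have hN' : C (N : ℂ)⁻¹ * C (N : ℂ) = 1 := by
        rw [← C_mul, inv_mul_cancel₀ (Nat.cast_ne_zero.2 hN.ne'), C_1]
      rw [map_smul, pow_map_eq_map_comp h, ← map_smul, smul_eq_C_mul]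
      congr 1
      simp only [mul_comp, pow_comp, X_comp, add_comp, one_comp, C_comp, neg_comp]
      generalize C (N : ℂ)⁻¹ = a at *
      generalize C (N : ℂ) = b at *
      have e1 : (-1 : ℂ[X]) + a * (Polynomial.X + b) = a * Polynomial.X := by
        linear_combination hN'
      have e2 : (1 : ℂ[X]) + a * Polynomial.X = a * (Polynomial.X + b) := by
        linear_combination -hN'
      rw [e1, e2]
      simp only [mul_pow]
      ring

/-- The falling factorials, as a sequence of polynomials with one member of each degree. -/
noncomputable def fallingFactorialSequence : Polynomial.Sequence ℂ where
  elems' := descPochhammer ℂ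
  degree_eq' n := by
    rw [degree_eq_natDegree (monic_descPochhammer ℂ n).ne_zero, descPochhammer_natDegree]

theorem descPochhammer_succ_comp_X_add_one (k : ℕ) :
    (descPochhammer ℂ (k + 1)).comp (Polynomial.X + 1) =
      descPochhammer ℂ (k + 1) + ((k : ℂ) + 1) • descPochhammer ℂ k := by
  have h := congrArg (fun p => p.comp (Polynomial.X + 1)) (descPochhammer_succ_comp_X_sub_one ℂ k)
  simp only [comp_assoc, sub_comp, X_comp, one_comp, add_sub_cancel_right, comp_X, smul_eq_mul,
    mul_comp, add_comp, natCast_comp] at h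
  rw [smul_eq_C_mul, C_add, C_1, C_eq_natCast]
  linear_combination -h

/-- Along a backward orbit `g` of `T` that ends in zero, `1 + T` acts like the translation of
polynomials by one. -/
theorem exists_polynomial_model {T : X →L[ℂ] X} {g : ℕ → X} (h0 : T (g 0) = 0)
    (hg : ∀ k, T (g (k + 1)) = g k) :
    ∃ Φ : ℂ[X] →ₗ[ℂ] X, (∀ p, (1 + T) (Φ p) = Φ (p.comp (Polynomial.X + 1))) ∧
      ∀ k, ∃ p, Φ p = g k := by
  have hlc : ∀ i, IsUnit (fallingFactorialSequence i).leadingCoeff := fun i => by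
    rw [show fallingFactorialSequence i = descPochhammer ℂ i from rfl,
      (monic_descPochhammer ℂ i).leadingCoeff]
    exact isUnit_one
  set b := fallingFactorialSequence.basis hlc with hb
  have hbk : ∀ k, b k = descPochhammer ℂ k := fun k => by
    rw [hb, Polynomial.Sequence.basis_eq_self]; rfl
  -- The factorial absorbs the factor k + 1 in the difference of the falling factorial of degree k +
  -- 1.
  set Φ : ℂ[X] →ₗ[ℂ] X := b.constr ℂ (fun k => (k.factorial : ℂ) • g k) with hΦ
  have hΦk : ∀ k, Φ (descPochhammer ℂ k) = (k.factorial : ℂ) • g k := fun k => by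
    rw [← hbk, hΦ, Module.Basis.constr_basis]
  refine ⟨Φ, fun p => ?_, fun k => ⟨(k.factorial : ℂ)⁻¹ • descPochhammer ℂ k, ?_⟩⟩
  · have : (1 + T).toLinearMap ∘ₗ Φ = Φ ∘ₗ taylor 1 := by
      refine b.ext fun k => ?_
      simp only [LinearMap.comp_apply, hbk, taylor_apply, C_1]
      cases k with
      | zero =>
        have h1 : Φ 1 = g 0 := by simpa using hΦk 0
        simp [h1, h0]
      | succ k =>
        rw [descPochhammer_succ_comp_X_add_one, map_add, map_smul, hΦk, hΦk, map_smul, smul_smul]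
        simp [hg, Nat.factorial_succ]
    simpa [taylor_apply] using LinearMap.congr_fun this p
  · rw [map_smul, hΦk, smul_smul, inv_mul_cancel₀ (Nat.cast_ne_zero.2 k.factorial_ne_zero), one_smul]

/-- If `T` maps a set with dense span onto itself and every element of the set is annihilated by a
power of `T`, then `T` perturbs every unimodular multiple of the identity to a mixing operator. -/
theorem isMixingOperator_smul_id_add {T : X →L[ℂ] X} {D : Set X}
    (hD : Dense (Submodule.span ℂ D : Set X)) (hnil : ∀ x ∈ D, ∃ k, (T ^ k) x = 0)
    (hsurj : ∀ x ∈ D, ∃ y ∈ D, T y = x) {lam : ℂ} (hlam : ‖lam‖ = 1) :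
    IsMixingOperator (lam • ContinuousLinearMap.id ℂ X + T) := by
  have hlam0 : lam ≠ 0 := by
    rintro rfl
    simp at hlam
  have hT : lam • ContinuousLinearMap.id ℂ X + T = lam • (1 + lam⁻¹ • T) := by
    rw [smul_add, smul_smul, mul_inv_cancel₀ hlam0, one_smul]
    rfl
  choose! ψ hψD hψ using hsurj
  have key : ∀ x ∈ D, ∃ Φ : ℂ[X] →ₗ[ℂ] X,
      (∀ p, (1 + lam⁻¹ • T) (Φ p) = Φ (p.comp (Polynomial.X + 1))) ∧ ∃ p, Φ p = x := by
    intro x hx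
    obtain ⟨k, hk⟩ := hnil x hx
    have hit : ∀ j, ψ^[j] x ∈ D := fun j => by
      induction j with
      | zero => exact hx
      | succ j ih => rw [Function.iterate_succ_apply']; exact hψD _ ih
    have hTit : ∀ j, T (ψ^[j + 1] x) = ψ^[j] x := fun j => by
      rw [Function.iterate_succ_apply']; exact hψ _ (hit j)
    have hTk : ∀ j, (T ^ j) (ψ^[j] x) = x := fun j => by
      induction j with
      | zero => simp
      | succ j ih => rw [pow_succ, mul_apply_eq_comp, hTit, ih]
    have hcomm : ∀ y, T ((T ^ k) y) = (T ^ k) (T y) := fun y => by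
      rw [← mul_apply_eq_comp, ← mul_apply_eq_comp, (Commute.refl T).pow_right k]
    -- Applying `T ^ k` shifts the backward orbit of `x` so that it starts at zero and passes
    -- through a multiple of `x` at index `k`.
    obtain ⟨Φ, hΦ, hΦg⟩ := exists_polynomial_model (T := lam⁻¹ • T)
      (g := fun j => lam ^ j • (T ^ k) (ψ^[j] x))
      (by
        rw [map_smul, smul_apply, Function.iterate_zero_apply, hk]
        simp)
      (fun j => by
        rw [map_smul, smul_apply, hcomm, hTit, smul_smul, pow_succ, mul_assoc,
          mul_inv_cancel₀ hlam0, mul_one])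
    obtain ⟨p, hp⟩ := hΦg k
    refine ⟨Φ, hΦ, (lam ^ k)⁻¹ • p, ?_⟩
    rw [map_smul, hp, hTk, smul_smul, inv_mul_cancel₀ (pow_ne_zero _ hlam0), one_smul]
  rw [hT]
  refine isMixingOperator_smul_of_dense hlam (hD.mono ?_) (hD.mono ?_)
  · refine Submodule.span_le.2 fun x hx => ?_
    obtain ⟨Φ, hΦ, p, rfl⟩ := key x hx
    exact map_mem_contractingVectors hΦ p
  · refine Submodule.span_le.2 fun x hx => ?_
    obtain ⟨Φ, hΦ, p, rfl⟩ := key x hx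
    exact map_mem_expandingVectors hΦ p

end Mixing

/-! ### Small operators with prescribed values on a basis. -/

section Perturbation

variable {X : Type*} [NormedAddCommGroup X] [NormedSpace ℂ X]

/-- A family `e` with dense span and uniformly bounded biorthogonal functionals. -/
structure IsBoundedBiorthogonal {ι : Type*} [DecidableEq ι] (e : ι → X) (c : ι → X →L[ℂ] ℂ)
    (K : ℝ) : Prop where
  apply_eq : ∀ i j, c i (e j) = if i = j then 1 else 0
  norm_le : ∀ i, ‖c i‖ ≤ K
  dense : Dense (Submodule.span ℂ (Set.range e) : Set X)

theorem IsBoundedBiorthogonal.comp_equiv {ι κ : Type*} [DecidableEq ι] [DecidableEq κ] {e : ι → X}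
    {c : ι → X →L[ℂ] ℂ} {K : ℝ} (h : IsBoundedBiorthogonal e c K) (σ : κ ≃ ι) :
    IsBoundedBiorthogonal (e ∘ σ) (c ∘ σ) K where
  apply_eq i j := by simp [h.apply_eq]
  norm_le i := h.norm_le _
  dense := by rw [σ.surjective.range_comp]; exact h.dense

/-- A normalised Schauder basis has uniformly bounded coordinate functionals. -/
theorem IsSchauderBasis.exists_isBoundedBiorthogonal [CompleteSpace X] {e : ℕ → X} (he : IsSchauderBasis e)
    (hn : IsNormalised e) : ∃ c K, IsBoundedBiorthogonal e c K := by
  obtain ⟨b, rfl⟩ := he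
  obtain ⟨M, hM⟩ := b.exists_norm_proj_le
  have hM0 : 0 ≤ M := (norm_nonneg _).trans (hM 0)
  refine ⟨b.coord, M + M, fun i j => ?_, fun i => ?_, fun x => ?_⟩
  · simp [b.ortho, Pi.single_apply]
  · refine ContinuousLinearMap.opNorm_le_bound _ (by positivity) fun x => ?_
    have h : b.coord i x • b i = b.proj (i + 1) x - b.proj i x := by
      simp [Finset.sum_range_succ]
    calc ‖b.coord i x‖ = ‖b.coord i x • b i‖ := by rw [norm_smul, hn i, mul_one]
      _ ≤ ‖b.proj (i + 1) x‖ + ‖b.proj i x‖ := by rw [h]; exact norm_sub_le _ _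
      _ ≤ M * ‖x‖ + M * ‖x‖ := add_le_add (ContinuousLinearMap.le_of_opNorm_le _ (hM _) x)
          (ContinuousLinearMap.le_of_opNorm_le _ (hM _) x)
      _ = (M + M) * ‖x‖ := by ring
  · refine mem_closure_of_tendsto (b.tendsto_proj x) (Eventually.of_forall fun n => ?_)
    rw [SchauderBasis.proj_apply]
    exact Submodule.sum_mem _ fun i _ => Submodule.smul_mem _ _ (Submodule.subset_span ⟨i, rfl⟩)

/-- A nuclear operator with prescribed values on part of a biorthogonal system. -/
theorem IsBoundedBiorthogonal.exists_operator [CompleteSpace X] {ι β : Type*} [DecidableEq ι] {e : ι → X}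
    {c : ι → X →L[ℂ] ℂ} {K : ℝ} (h : IsBoundedBiorthogonal e c K) {f : β → ι}
    (hf : Function.Injective f) {a : β → X} {δ : β → ℝ} (hδ : Summable δ)
    (ha : ∀ b, ‖a b‖ ≤ δ b) :
    ∃ P : X →L[ℂ] X, ‖P‖ ≤ K * ∑' b, δ b ∧ (∀ b, P (e (f b)) = a b) ∧
      ∀ i, i ∉ Set.range f → P (e i) = 0 := by
  have hb : ∀ b, ‖(c (f b)).smulRight (a b)‖ ≤ K * δ b := fun b => by
    rw [ContinuousLinearMap.norm_smulRight_apply]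
    exact mul_le_mul (h.norm_le _) (ha b) (norm_nonneg _) ((norm_nonneg _).trans (h.norm_le (f b)))
  have hs := hδ.mul_left K
  have hsum : Summable fun b => (c (f b)).smulRight (a b) := Summable.of_norm_bounded hs hb
  have happ : ∀ x, (∑' b, (c (f b)).smulRight (a b)) x = ∑' b, c (f b) x • a b := fun x =>
    (ContinuousLinearMap.apply ℂ X x).map_tsum hsum
  refine ⟨∑' b, (c (f b)).smulRight (a b), ?_, fun b => ?_, fun i hi => ?_⟩
  · rw [← tsum_mul_left]
    exact tsum_of_norm_bounded hs.hasSum hb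
  · rw [happ, tsum_eq_single b fun b' hb' => ?_]
    · simp [h.apply_eq]
    · simp [h.apply_eq, hf.ne hb']
  · rw [happ]
    simp only [h.apply_eq]
    refine (tsum_congr fun b => ?_).trans tsum_zero
    rw [if_neg fun hbi => hi ⟨b, hbi⟩, zero_smul]

/-- Strict positivity matters twice: for tolerances on the small weights and for nonzero replacement
weights. -/
theorem exists_pos_summable_tsum_le {β : Type*} [Countable β] {ε : ℝ} (hε : 0 < ε) :
    ∃ δ : β → ℝ, (∀ b, 0 < δ b) ∧ Summable δ ∧ ∑' b, δ b ≤ ε := by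
  obtain ⟨δ, hδ, s, hs, hsε⟩ := NNReal.exists_pos_sum_of_countable
    (ε := ⟨ε, hε.le⟩) (fun h => hε.ne' (congrArg NNReal.toReal h)) β
  refine ⟨fun b => δ b, hδ, NNReal.summable_coe.2 hs.summable, ?_⟩
  rw [← NNReal.coe_tsum, hs.tsum_eq]
  exact hsε.le

end Perturbation

/-! ### Cutting a shift into blocks and rejoining them backwards. -/

section Shift

variable {X : Type*} [NormedAddCommGroup X] [NormedSpace ℂ X]
variable {ι : Type*} [LinearOrder ι] [SuccOrder ι] [IsSuccArchimedean ι]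

/-- Each strict increase advances at least to the successor, so `n k` dominates the k-th successor
of `n 0`. -/
theorem StrictMono.exists_le_of_isSuccArchimedean {n : ℕ → ι} (hn : StrictMono n) (i : ι) :
    ∃ j, i ≤ n j := by
  rcases le_total i (n 0) with h | h
  · exact ⟨0, h⟩
  · obtain ⟨k, rfl⟩ := exists_succ_iterate_of_le h
    refine ⟨k, ?_⟩
    induction k with
    | zero => exact le_rfl
    | succ k ih =>
      rw [Function.iterate_succ_apply']
      exact (Order.succ_mono (ih (Order.le_succ_iterate _ _))).trans
        (Order.succ_le_of_lt (hn k.lt_succ_self))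

/-- Cut the index set after the places `n 0 < n 1 < …`, where `s j` is the first index of the block
that ends at `n j`. An operator that shifts forward inside each block, maps the end of a block to a
multiple of the beginning of the preceding block, and annihilates the end of the first block yields
mixing perturbations of unimodular multiples of the identity. -/
theorem isMixingOperator_smul_id_add_of_blocks [NoMaxOrder ι] {e : ι → X}
    (hd : Dense (Submodule.span ℂ (Set.range e) : Set X)) {n s : ℕ → ι} (hn : StrictMono n)
    (hs0 : s 0 ≤ n 0) (hs : ∀ j, s (j + 1) = Order.succ (n j))
    (hpred : ∀ i, i = s 0 ∨ ∃ i', Order.succ i' = i) {T : X →L[ℂ] X} (hT0 : T (e (n 0)) = 0)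
    (hTn : ∀ j, ∃ v : ℂ, v ≠ 0 ∧ T (e (n (j + 1))) = v • e (s j))
    (hT : ∀ i, i ∉ Set.range n → ∃ v : ℂ, v ≠ 0 ∧ T (e i) = v • e (Order.succ i))
    {lam : ℂ} (hlam : ‖lam‖ = 1) :
    IsMixingOperator (lam • ContinuousLinearMap.id ℂ X + T) := by
  have hsn : ∀ j, s j ≤ n j := fun j => by
    cases j with
    | zero => exact hs0
    | succ j => rw [hs]; exact Order.succ_le_of_lt (hn j.lt_succ_self)
  have hstep : ∀ i i' (v : ℂ), T (e i) = v • e i' → (∃ k, (T ^ k) (e i') = 0) →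
      ∃ k, (T ^ k) (e i) = 0 := by
    rintro i i' v h ⟨k, hk⟩
    exact ⟨k + 1, by rw [pow_succ, mul_apply_eq_comp, h, map_smul, hk, smul_zero]⟩
  -- Double induction: on the bound `n j`, then on the number of successor steps from `i` to `n j`.
  have hnil : ∀ j i, i ≤ n j → ∃ k, (T ^ k) (e i) = 0 := by
    intro j
    induction j with
    | zero =>
      intro i hi
      obtain ⟨d, hd⟩ := exists_succ_iterate_of_le hi
      induction d generalizing i with
      | zero => exact ⟨1, by rw [← hT0, ← hd]; simp⟩
      | succ d ih =>
        have hlt : i < n 0 := by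
          rw [← hd, Function.iterate_succ_apply]
          exact (Order.lt_succ i).trans_le (Order.le_succ_iterate _ _)
        obtain ⟨v, -, hv⟩ := hT i (by
          rintro ⟨j, rfl⟩
          exact absurd (hn.lt_iff_lt.1 hlt) (Nat.not_lt_zero j))
        exact hstep _ _ v hv (ih _ (Order.succ_le_of_lt hlt) hd)
    | succ j ihj =>
      intro i hi
      obtain ⟨d, hd⟩ := exists_succ_iterate_of_le hi
      induction d generalizing i with
      | zero =>
        obtain ⟨v, -, hv⟩ := hTn j
        obtain rfl : i = n (j + 1) := hd
        exact hstep _ _ v hv (ihj _ (hsn j))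
      | succ d ih =>
        have hlt : i < n (j + 1) := by
          rw [← hd, Function.iterate_succ_apply]
          exact (Order.lt_succ i).trans_le (Order.le_succ_iterate _ _)
        by_cases hr : i ∈ Set.range n
        · obtain ⟨l, rfl⟩ := hr
          exact ihj _ (hn.monotone (Nat.le_of_lt_succ (hn.lt_iff_lt.1 hlt)))
        · obtain ⟨v, -, hv⟩ := hT i hr
          exact hstep _ _ v hv (ih _ (Order.succ_le_of_lt hlt) hd)
  have hpre : ∀ i, ∃ i' : ι, ∃ v : ℂ, v ≠ 0 ∧ T (e i') = v • e i := by
    intro i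
    by_cases hi : ∃ j, i = s j
    · obtain ⟨j, rfl⟩ := hi
      exact ⟨_, hTn j⟩
    · push Not at hi
      obtain ⟨i', rfl⟩ := (hpred i).resolve_left (hi 0)
      exact ⟨i', hT i' fun ⟨j, hj⟩ => hi (j + 1) (by rw [hs, hj])⟩
  -- All scalar multiples are included so that the nonzero factors `v` can be divided out.
  refine isMixingOperator_smul_id_add (D := {x | ∃ (a : ℂ) (i : ι), x = a • e i})
    (hd.mono (Submodule.span_mono ?_)) ?_ ?_ hlam
  · rintro _ ⟨i, rfl⟩
    exact ⟨1, i, (one_smul _ _).symm⟩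
  · rintro _ ⟨a, i, rfl⟩
    obtain ⟨j, hj⟩ := hn.exists_le_of_isSuccArchimedean i
    obtain ⟨k, hk⟩ := hnil j i hj
    exact ⟨k, by rw [map_smul, hk, smul_zero]⟩
  · rintro _ ⟨a, i, rfl⟩
    obtain ⟨i', v, hv, h⟩ := hpre i
    refine ⟨_, ⟨a * v⁻¹, i', rfl⟩, ?_⟩
    rw [map_smul, h, smul_smul, mul_assoc, inv_mul_cancel₀ hv, mul_one]

/-- A weighted shift with weights tending to zero along an increasing sequence of indices, added to
a unimodular multiple of the identity, is a limit of mixing operators. -/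
theorem IsBoundedBiorthogonal.smul_id_add_mem_closure [CompleteSpace X] [NoMaxOrder ι] [Countable ι]
    {e : ι → X} {c : ι → X →L[ℂ] ℂ} {K : ℝ} (h : IsBoundedBiorthogonal e c K) (he : IsNormalised e)
    (hpred : ∀ i : ι, IsMin i ∨ ∃ i', Order.succ i' = i) {S : X →L[ℂ] X} {w : ι → ℂ}
    (hS : ∀ i, S (e i) = w i • e (Order.succ i)) (hw : HasNullSubsequence w)
    {lam : ℂ} (hlam : ‖lam‖ = 1) :
    lam • ContinuousLinearMap.id ℂ X + S ∈ closure (mixingOperators X) := by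
  rw [Metric.mem_closure_iff]
  intro ε hε
  -- Each of `P` and `Q` gets norm at most ε/4; `|K| + 1` avoids division by zero.
  have hε' : 0 < ε / (4 * (|K| + 1)) := by positivity
  obtain ⟨δ, hδ0, hδ, hδε⟩ := exists_pos_summable_tsum_le (β := ℕ) hε'
  obtain ⟨η, hη0, hη, hηε⟩ := exists_pos_summable_tsum_le (β := ι) hε'
  have hbound : ∀ t : ℝ, 0 ≤ t → t ≤ ε / (4 * (|K| + 1)) → K * t ≤ ε / 4 := fun t ht0 ht =>
    calc K * t ≤ (|K| + 1) * t := mul_le_mul_of_nonneg_right ((le_abs_self K).trans (by simp)) ht0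
      _ ≤ (|K| + 1) * (ε / (4 * (|K| + 1))) := by gcongr
      _ = ε / 4 := by field_simp
  obtain ⟨n, hn, hwδ⟩ : ∃ n : ℕ → ι, StrictMono n ∧ ∀ j, ‖w (n j)‖ ≤ δ j := by
    obtain ⟨m, hm, hlim⟩ := hw
    obtain ⟨φ, hφ, hφ'⟩ := extraction_forall_of_eventually fun j =>
      hlim.eventually (ge_mem_nhds (hδ0 j))
    exact ⟨m ∘ φ, hm.comp hφ, hφ'⟩
  obtain ⟨s₀, hs₀, hs₀'⟩ : ∃ s₀, s₀ ≤ n 0 ∧ ∀ i, i = s₀ ∨ ∃ i', Order.succ i' = i := by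
    by_cases hmin : ∃ m : ι, IsMin m
    · obtain ⟨m, hm⟩ := hmin
      exact ⟨m, hm.isBot _, fun i => (hpred i).imp_left fun hi => le_antisymm (hi.isBot _) (hm.isBot _)⟩
    -- Without a least index the first block is unbounded below; `s 0` is only where the end of the
    -- next block lands.
    · exact ⟨n 0, le_rfl, fun i => .inr ((hpred i).resolve_left fun hi => hmin ⟨i, hi⟩)⟩
  let s : ℕ → ι := fun j => Nat.casesOn j s₀ fun j => Order.succ (n j)
  -- `a i` is the value of `Q` at `e i`: it rejoins the blocks and repairs zero weights inside them.
  -- `P` cancels `S` at the cuts.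
  have hex : ∀ i, ∃ a : X, ‖a‖ ≤ η i ∧ (i = n 0 → a = 0) ∧
      (∀ j, i = n (j + 1) → a = (η i : ℂ) • e (s j)) ∧
      (i ∉ Set.range n → w i = 0 → a = (η i : ℂ) • e (Order.succ i)) ∧
      (i ∉ Set.range n → w i ≠ 0 → a = 0) := by
    intro i
    have hnorm : ∀ i', ‖(η i : ℂ) • e i'‖ ≤ η i := fun i' => by
      rw [norm_smul, he, mul_one, Complex.norm_of_nonneg (hη0 i).le]
    by_cases hi : i ∈ Set.range n
    · obtain ⟨j, rfl⟩ := hi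
      obtain _ | j := j
      · exact ⟨0, by simpa using (hη0 _).le, by simp [hn.injective.eq_iff]⟩
      · refine ⟨_, hnorm (s j), by simp [hn.injective.eq_iff], fun l hl => ?_, by simp, by simp⟩
        obtain rfl : j = l := by simpa [hn.injective.eq_iff] using hl
        rfl
    · have h0 : ∀ j, i ≠ n j := fun j hj => hi ⟨j, hj.symm⟩
      by_cases hwi : w i = 0
      · exact ⟨_, hnorm (Order.succ i), by simp [h0, hwi]⟩
      · exact ⟨0, by simpa using (hη0 _).le, by simp [h0, hwi]⟩
  choose a ha ha0 han haz haw using hex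
  obtain ⟨P, hP, hPn, hP0⟩ := h.exists_operator hn.injective
    (a := fun j => -(w (n j) • e (Order.succ (n j)))) hδ
    (fun j => by rw [norm_neg, norm_smul, he, mul_one]; exact hwδ j)
  obtain ⟨Q, hQ, hQe, -⟩ := h.exists_operator Function.injective_id hη ha
  have hηC : ∀ i, (η i : ℂ) ≠ 0 := fun i => Complex.ofReal_ne_zero.2 (hη0 i).ne'
  have hTn : ∀ j, (S + (P + Q)) (e (n j)) = a (n j) := fun j => by
    have := hQe (n j)
    simp only [id] at this
    simp [hS, hPn, this]
  have hT : ∀ i, i ∉ Set.range n → (S + (P + Q)) (e i) = w i • e (Order.succ i) + a i :=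
    fun i hi => by
      have := hQe i
      simp only [id] at this
      simp [hS, hP0 i hi, this]
  refine ⟨lam • ContinuousLinearMap.id ℂ X + (S + (P + Q)),
    isMixingOperator_smul_id_add_of_blocks h.dense hn (s := s) hs₀ (fun j => rfl) hs₀' ?_ ?_ ?_ hlam,
    ?_⟩
  · rw [hTn, ha0 _ rfl]
  · exact fun j => ⟨_, hηC _, by rw [hTn, han _ j rfl]⟩
  · intro i hi
    by_cases hwi : w i = 0
    · exact ⟨_, hηC i, by rw [hT i hi, haz i hi hwi, hwi, zero_smul, zero_add]⟩
    · exact ⟨_, hwi, by rw [hT i hi, haw i hi hwi, add_zero]⟩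
  · have h1 := hP.trans (hbound _ (tsum_nonneg fun j => (hδ0 j).le) hδε)
    have h2 := hQ.trans (hbound _ (tsum_nonneg fun i => (hη0 i).le) hηε)
    have h3 := norm_add_le P Q
    rw [dist_eq_norm]
    have : lam • ContinuousLinearMap.id ℂ X + S - (lam • ContinuousLinearMap.id ℂ X + (S + (P + Q)))
        = -(P + Q) := by abel
    rw [this, norm_neg]
    linarith

end Shift

/-! ### Null subsequences of weights from quasinilpotency. -/

section Quasinilpotent

variable {X : Type*} [NormedAddCommGroup X] [NormedSpace ℂ X] [CompleteSpace X]

/-- The weights of a quasinilpotent forward shift tend to zero along a subsequence. -/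
theorem IsQuasinilpotent.hasNullSubsequence {S : X →L[ℂ] X} (hS : IsQuasinilpotent S) {e : ℕ → X}
    (he : IsNormalised e) {w : ℕ → ℂ} (hw : IsWeightedForwardShift S e w) :
    HasNullSubsequence w := by
  have hfreq : ∀ k : ℕ, ∃ᶠ n in atTop, ‖w n‖ < 1 / ((k : ℝ) + 1) := by
    -- If the weights stay above `d` from `N` on, then ‖S^m‖ ≥ d^m for all m, so the spectral radius
    -- is at least `d`.
    intro k hk
    simp only [not_lt, eventually_atTop] at hk
    obtain ⟨N, hN⟩ := hk
    set d : ℝ := 1 / ((k : ℝ) + 1) with hd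
    have hd0 : 0 < d := by positivity
    have hlow : ∀ m, d ^ m ≤ ‖(S ^ m) (e N)‖ := by
      suffices ∀ m, ∃ v : ℂ, d ^ m ≤ ‖v‖ ∧ (S ^ m) (e N) = v • e (N + m) by
        intro m
        obtain ⟨v, hv, h⟩ := this m
        rwa [h, norm_smul, he, mul_one]
      intro m
      induction m with
      | zero => exact ⟨1, by simp, by simp⟩
      | succ m ih =>
        obtain ⟨v, hv, h⟩ := ih
        refine ⟨v * w (N + m), ?_, ?_⟩
        · rw [norm_mul, pow_succ]
          exact mul_le_mul hv (hN _ (Nat.le_add_right _ _)) hd0.le (norm_nonneg _)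
        · rw [pow_succ', mul_apply_eq_comp, h, map_smul, hw, smul_smul, add_assoc]
    have hpow : ∀ m, d ^ m ≤ ‖S ^ m‖ := fun m => by
      simpa [he N] using (hlow m).trans ((S ^ m).le_opNorm (e N))
    have hlim := spectrum.pow_norm_pow_one_div_tendsto_nhds_spectralRadius S
    have hrad : spectralRadius ℂ S = 0 := by
      rw [spectralRadius, show spectrum ℂ S = {0} from hS]
      simp
    rw [hrad] at hlim
    have hge : ENNReal.ofReal d ≤ 0 := by
      refine ge_of_tendsto hlim ?_
      filter_upwards [eventually_gt_atTop 0] with m hm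
      refine ENNReal.ofReal_le_ofReal ?_
      calc d = (d ^ m) ^ (1 / m : ℝ) := by
            rw [one_div, Real.pow_rpow_inv_natCast hd0.le hm.ne']
        _ ≤ _ := Real.rpow_le_rpow (by positivity) (hpow m) (by positivity)
    simp only [nonpos_iff_eq_zero, ENNReal.ofReal_eq_zero] at hge
    exact hge.not_gt hd0
  obtain ⟨φ, hφ, h⟩ := extraction_forall_of_frequently hfreq
  exact ⟨φ, hφ, squeeze_zero (fun _ => norm_nonneg _) (fun j => (h j).le)
    tendsto_one_div_add_atTop_nhds_zero_nat⟩

end Quasinilpotent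

theorem mainTheorem5 {X : Type*} [NormedAddCommGroup X] [NormedSpace ℂ X] [CompleteSpace X]
    [TopologicalSpace.SeparableSpace X] (hX : ¬ FiniteDimensional ℂ X)
    (S : X →L[ℂ] X) (lam : ℂ) (hlam : ‖lam‖ = 1) :
    ((∀ (e : ℕ → X) (w : ℕ → ℂ), IsSchauderBasis e → IsNormalised e →
        IsWeightedForwardShift S e w → HasNullSubsequence w →
        lam • ContinuousLinearMap.id ℂ X + S ∈ closure (mixingOperators X)) ∧
      (∀ (e : ℤ → X) (w : ℤ → ℂ), IsBilateralSchauderBasis e → IsNormalised e →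
        IsWeightedBilateralShift S e w → HasNullSubsequence w →
        lam • ContinuousLinearMap.id ℂ X + S ∈ closure (mixingOperators X))) ∧
    ((∀ (e : ℕ → X) (w : ℕ → ℂ), IsSchauderBasis e → IsNormalised e →
        IsWeightedForwardShift S e w → IsQuasinilpotent S →
        lam • ContinuousLinearMap.id ℂ X + S ∈ closure (mixingOperators X)) ∧
      (∀ (e : ℤ → X) (w : ℤ → ℂ), IsBilateralSchauderBasis e → IsNormalised e →
        IsWeightedBilateralShift S e w → IsQuasinilpotent S →
        lam • ContinuousLinearMap.id ℂ X + S ∈ closure (mixingOperators X))) := by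
  have forward : ∀ (e : ℕ → X) (w : ℕ → ℂ), IsSchauderBasis e → IsNormalised e →
      IsWeightedForwardShift S e w → HasNullSubsequence w →
      lam • ContinuousLinearMap.id ℂ X + S ∈ closure (mixingOperators X) := by
    intro e w hb he hS hw
    obtain ⟨c, K, h⟩ := hb.exists_isBoundedBiorthogonal he
    refine h.smul_id_add_mem_closure he (fun i => ?_) hS hw hlam
    cases i with
    | zero => exact .inl isMin_bot
    | succ i => exact .inr ⟨i, rfl⟩
  have bilateral : ∀ (e : ℤ → X) (w : ℤ → ℂ), IsBilateralSchauderBasis e → IsNormalised e →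
      IsWeightedBilateralShift S e w → HasNullSubsequence w →
      lam • ContinuousLinearMap.id ℂ X + S ∈ closure (mixingOperators X) := by
    rintro e w ⟨σ, hb⟩ he hS hw
    obtain ⟨c, K, h⟩ := hb.exists_isBoundedBiorthogonal fun k => he (σ k)
    -- Biorthogonality does not depend on the enumeration, so the order of ℤ can be restored.
    have h' : IsBoundedBiorthogonal e (c ∘ σ.symm) K := by
      convert h.comp_equiv σ.symm
      ext i
      simp
    exact h'.smul_id_add_mem_closure he (fun i => .inr ⟨i - 1, sub_add_cancel i 1⟩) hS hw hlam
  refine ⟨⟨forward, bilateral⟩, fun e w hb he hS hq => ?_, fun e w hb he hS hq => ?_⟩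
  · exact forward e w hb he hS (hq.hasNullSubsequence he hS)
  · obtain ⟨n, hn, hlim⟩ := hq.hasNullSubsequence (e := fun k : ℕ => e k) (w := fun k : ℕ => w k)
      (fun k => he k) (fun k => by simpa using hS k)
    exact bilateral e w hb he hS ⟨fun j => n j, fun i j hij => Int.ofNat_lt.2 (hn hij), hlim⟩
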